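/- Let $L^2(\mathbb T)$ and $L^\infty(\mathbb T)$ be taken with respect to normalized Lebesgue measure $m$ on the unit circle $\mathbb T$, and let $H^2\subset L^2(\mathbb T)$ be the Hardy space. For closed subspaces $E_1, E_2\subseteq H^2$ and $g\in L^\infty(\mathbb T)$ let $T_g^{E_1,E_2}:E_1\to E_2$, $f\mapsto P_{E_2}(gf)$, be the generalized Toeplitz operator, where $P_{E_2}$ is the orthogonal projection of $L^2(\mathbb T)$ onto $E_2$; thus $\ker T_g^{E_1,E_2}=\{f\in E_1: gf\in E_2^\perp\}$, where $E_2^{\perp}$ is the orthogonal complement in $L^2(\mathbb T)$. For $k\in E_1$, the minimal kernel $K_{\min}^{E_1,E_2}(k)$ is the smallest (with respect to inclusion) subspace of the form $\ker T_g^{E_1,E_2}$, $g\in L^\infty(\mathbb T)$, that contains $k$. An inner function is a $u\in H^\infty$ with $|u|=1$ a.e. on $\mathbb T$. A function $p\in H^2$ is outer if there is $f$ with $\log|f|\in L^1(\mathbb T)$ such that $p(z)=\exp\left(\int_{\mathbb T}\frac{\zeta+z}{\zeta-z}\log|f(\zeta)|\,dm(\zeta)\right)$ for $|z|<1$. **Theorem.**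 Let $E_2=\Theta_2H^2$ with $\Theta_2$ inner (equivalently, let $E_2$ be a closed subspace of $H^2$ with $zE_2\subsetneq E_2$). Let $k=\theta p$, where $\theta$ is a rational inner function and $p\in H^2$ is outer. If $$\dim\ker T_{\Theta_2\overline{zp}/p}^{H^2,E_2}<\infty,$$ then the minimal kernel $K_{\min}^{H^2,E_2}(k)$ exists and $$\dim K_{\min}^{H^2,E_2}(k)<\infty.$$ -/

import Mathlib

open MeasureTheory AddCircle
open scoped ENNReal ComplexConjugate Polynomial

noncomputable section

namespace GenToeplitz

/-- The unit circle `𝕋`, parametrised by `t ↦ e^{2πit}`, `t ∈ ℝ/ℤ`. -/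
abbrev T : Type := AddCircle (1 : ℝ)

/-- Normalised Lebesgue measure on the circle. -/
abbrev m : Measure T := haarAddCircle

/-- `L²(𝕋)`. -/
abbrev L2 : Type := Lp ℂ 2 m

/-- `L^∞(𝕋)`. -/
abbrev LInf : Type := Lp ℂ ∞ m

/-- The coordinate function `z = e^{2πit}` on the circle. -/
def coord (t : T) : ℂ := fourier 1 t

lemma norm_coord (t : T) : ‖coord t‖ = 1 := by
  rw [coord, fourier_apply, Circle.norm_coe]

lemma continuous_coord : Continuous coord := (fourier (T := (1 : ℝ)) 1).continuous

/-- Multiplication `M_g : f ↦ g f` on `L²(𝕋)` by `g ∈ L^∞(𝕋)`. -/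
def mulOp (g : LInf) : L2 →L[ℂ] L2 := (ContinuousLinearMap.mul ℂ ℂ).holderL m ∞ 2 2 g

lemma coeFn_mulOp (g : LInf) (f : L2) : ⇑(mulOp g f) =ᵐ[m] fun t => g t * f t := by
  simpa [mulOp] using (ContinuousLinearMap.mul ℂ ℂ).coeFn_holder (r := 2) g f

/-- The Hardy space `H²`, as a subspace of `L²(𝕋)`: all negative Fourier coefficients vanish. -/
def H2 : Submodule ℂ L2 where
  carrier := {f | ∀ n : ℤ, n < 0 → fourierCoeff f n = 0}
  zero_mem' n _ := by rw [← fourierBasis_repr]; simp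
  add_mem' {f g} hf hg n hn := by
    rw [← fourierBasis_repr, map_add, lp.coeFn_add, Pi.add_apply, fourierBasis_repr,
      fourierBasis_repr, hf n hn, hg n hn, add_zero]
  smul_mem' c f hf n hn := by
    rw [← fourierBasis_repr, map_smul, lp.coeFn_smul, Pi.smul_apply, fourierBasis_repr,
      hf n hn, smul_zero]

lemma isClosed_H2 : IsClosed (H2 : Set L2) := by
  have : (H2 : Set L2) = ⋂ n : ℤ, ⋂ _ : n < 0, {f : L2 | inner ℂ (fourierBasis n) f = 0} := by
    ext f
    simp only [SetLike.mem_coe, Set.mem_iInter, Set.mem_ofPred_eq]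
    refine forall_congr' fun n => forall_congr' fun _ => ?_
    rw [← HilbertBasis.repr_apply_apply, fourierBasis_repr]
  rw [this]
  exact isClosed_iInter fun n => isClosed_iInter fun _ =>
    isClosed_eq (continuous_const.inner continuous_id) continuous_const

/-- An inner function `u`: an element of `H^∞` with `|u| = 1` almost everywhere on the circle. -/
structure InnerFunction where
  /-- the boundary function of `u` -/
  toLInf : LInf
  fourierCoeff_neg : ∀ n : ℤ, n < 0 → fourierCoeff toLInf n = 0
  norm_eq_one : ∀ᵐ t ∂m, ‖toLInf t‖ = 1

lemma InnerFunction.norm_mulOp (u : InnerFunction) (f : L2) : ‖mulOp u.toLInf f‖ = ‖f‖ := by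
  rw [Lp.norm_def, Lp.norm_def]
  congr 1
  refine eLpNorm_congr_norm_ae ?_
  filter_upwards [coeFn_mulOp u.toLInf f, u.norm_eq_one] with t h1 h2
  rw [h1, norm_mul, h2, one_mul]

/-- The subspace `u H²` for an inner function `u`. By the Beurling-Helson theorem these are exactly
the closed subspaces `E` of `H²` with `zE ⊊ E`. -/
def InnerFunction.subspace (u : InnerFunction) : Submodule ℂ L2 :=
  H2.map (mulOp u.toLInf : L2 →ₗ[ℂ] L2)

instance (u : InnerFunction) : u.subspace.HasOrthogonalProjection := by
  have hiso : Isometry (mulOp u.toLInf) :=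
    AddMonoidHomClass.isometry_of_norm _ u.norm_mulOp
  have hcl : IsClosed (u.subspace : Set L2) := by
    have : (u.subspace : Set L2) = mulOp u.toLInf '' (H2 : Set L2) := rfl
    rw [this]
    exact hiso.isClosedEmbedding.isClosedMap _ isClosed_H2
  have : CompleteSpace u.subspace := hcl.completeSpace_coe
  infer_instance

/-- `u` is rational: it agrees on the circle with a quotient of two polynomials in `z`. -/
def InnerFunction.IsRational (u : InnerFunction) : Prop :=
  ∃ P Q : ℂ[X], Q ≠ 0 ∧ ∀ᵐ t ∂m, u.toLInf t = P.eval (coord t) / Q.eval (coord t)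

/-- `p ∈ H²` is outer: its analytic extension `p(z) = ∑_{n ≥ 0} p̂(n) zⁿ` to the unit disc is
`exp (∫ (ζ + z) / (ζ - z) log |f(ζ)| dm(ζ))` for some `f` with `log |f| ∈ L¹(𝕋)`; the real function
`φ` is `log |f|`. -/
def IsOuter (p : L2) : Prop :=
  p ∈ H2 ∧ ∃ φ : T → ℝ, Integrable φ m ∧ ∀ z : ℂ, ‖z‖ < 1 →
    HasSum (fun n : ℕ => fourierCoeff p n * z ^ n)
      (Complex.exp (∫ t, (coord t + z) / (coord t - z) * (φ t : ℂ) ∂m))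

/-- The generalized Toeplitz operator `T_g^{E₁,E₂} = P_{E₂} (M_g|_{E₁}) : E₁ → E₂`. -/
def toeplitz (E₁ E₂ : Submodule ℂ L2) [E₂.HasOrthogonalProjection] (g : LInf) : E₁ →L[ℂ] E₂ :=
  E₂.orthogonalProjectionOnto ∘L mulOp g ∘L E₁.subtypeL

/-- The kernel of `T_g^{E₁,E₂}`, as a subspace of `L²(𝕋)` (contained in `E₁`). -/
def toeplitzKer (E₁ E₂ : Submodule ℂ L2) [E₂.HasOrthogonalProjection] (g : LInf) :
    Submodule ℂ L2 :=
  (LinearMap.ker (toeplitz E₁ E₂ g : E₁ →ₗ[ℂ] E₂)).map E₁.subtype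

lemma mem_toeplitzKer {E₁ E₂ : Submodule ℂ L2} [E₂.HasOrthogonalProjection] {g : LInf} {f : L2} :
    f ∈ toeplitzKer E₁ E₂ g ↔ f ∈ E₁ ∧ mulOp g f ∈ E₂ᗮ := by
  simp [toeplitzKer, toeplitz, and_comm]

/-- `K` is the minimal generalized Toeplitz kernel `K_min^{E₁,E₂}(k)`: the smallest subspace of the
form `ker T_g^{E₁,E₂}`, `g ∈ L^∞(𝕋)`, that contains `k`. -/
def IsMinKernel (E₁ E₂ : Submodule ℂ L2) [E₂.HasOrthogonalProjection] (k : L2)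
    (K : Submodule ℂ L2) : Prop :=
  IsLeast {N : Submodule ℂ L2 | ∃ g : LInf, N = toeplitzKer E₁ E₂ g ∧ k ∈ N} K

lemma memLp_symbol (u : InnerFunction) (p : L2) :
    MemLp (fun t => u.toLInf t * conj (coord t * p t) / p t) ∞ m := by
  have hp : AEMeasurable p m := (Lp.aestronglyMeasurable p).aemeasurable
  have hu : AEMeasurable u.toLInf m := (Lp.aestronglyMeasurable u.toLInf).aemeasurable
  have hc : AEMeasurable coord m := continuous_coord.measurable.aemeasurable
  refine memLp_top_of_bound (C := 1) ?_ ?_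
  · exact ((hu.mul (Complex.continuous_conj.measurable.comp_aemeasurable (hc.mul hp))).div
      hp).aestronglyMeasurable
  · filter_upwards [u.norm_eq_one] with t ht
    rw [norm_div, norm_mul, ht, RCLike.norm_conj, norm_mul, norm_coord, one_mul, one_mul]
    exact div_self_le_one _

/-- The symbol `Θ \overline{z p} / p ∈ L^∞(𝕋)`, for `Θ` inner and `p` (almost everywhere nonzero)
in `L²(𝕋)`. -/
def symbol (u : InnerFunction) (p : L2) : LInf := (memLp_symbol u p).toLp

end GenToeplitz

end

open GenToeplitz

namespace GenToeplitz

open Filter Topology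

/-! ### Fourier coefficients of products, and Parseval on the circle -/

section FourierCoefficients

/-! The minimal kernel has the explicit symbol `g₀ = conj θ · Θ₂ conj(zp)/p`. Since `conj(Θ₂) g f`
and `g f` differ by a unimodular factor, `f ∈ H²` lies in the kernel of `g` iff `conj(conj(Θ₂) g f)
∈ zH²` (`mem_toeplitzKer_iff`). For `g₀` and `f = θp` this function is `zp`, so `θp` is in the
kernel.

For minimality let `θp` lie in the kernel of `g` and `f` in that of `g₀`. Write `w, v` for the
functions attached to `g` with `θp` and with `f`, and `h` for the one attached to `g₀` with `f`.
Then `z v p = w h` with `w, h ∈ zH²`, and `v ∈ zH²` is wanted. This is division by an outer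
function, carried out through cyclicity (`IsOuter.exists_tendsto`): there are `q_k ∈ H^∞` with `q_k
p → 1` in `L²`, so each coefficient of `v` is the limit of those of `v q_k p`, whose vanishing is
read off from `w (q_k h)`. The `q_k` are the outer functions of a truncation of `-log|f|`.

Finite dimensionality is a codimension count. With `θ = P/Q` and `F = conj(Θ₂) g f`, one has `Q F =
P · (conj θ F)`. If `f` lies in the kernel of `conj θ · g`, the coefficients of `F` therefore obey a
linear recursion, and the vanishing of finitely many of them puts `f` in the kernel of `g`. Hence
passing from `g` to `conj θ · g` adds at most `deg P + deg Q` dimensions. -/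

theorem norm_fourier_apply (n : ℤ) (t : T) : ‖(fourier n t : ℂ)‖ = 1 := by
  rw [fourier_apply, Circle.norm_coe]

theorem coord_pow (n : ℕ) (t : T) : coord t ^ n = fourier (n : ℤ) t := by
  induction n with
  | zero => rw [pow_zero, Nat.cast_zero, fourier_zero]
  | succ n ih => rw [pow_succ, ih, coord, ← fourier_add, Nat.cast_succ]

theorem fourierCoeff_conj (f : T → ℂ) (n : ℤ) :
    fourierCoeff (fun t => conj (f t)) n = conj (fourierCoeff f (-n)) := by
  rw [fourierCoeff, fourierCoeff, ← integral_conj]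
  refine integral_congr_ae (.of_forall fun t => ?_)
  simp only [smul_eq_mul, map_mul]
  rw [← fourier_neg]
  simp only [neg_neg]

theorem fourierCoeff_fourier_mul (k : ℤ) (f : T → ℂ) (n : ℤ) :
    fourierCoeff (fun t => fourier k t * f t) n = fourierCoeff f (n - k) := by
  rw [fourierCoeff, fourierCoeff]
  refine integral_congr_ae (.of_forall fun t => ?_)
  simp only [smul_eq_mul]
  rw [← mul_assoc, ← fourier_add, neg_sub, sub_eq_add_neg, add_comm]

theorem memLp_fourier_mul (k : ℤ) {f : T → ℂ} {q : ℝ≥0∞} (hf : MemLp f q m) :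
    MemLp (fun t => fourier k t * f t) q m := by
  refine hf.of_le ((fourier k).continuous.aestronglyMeasurable.mul hf.1)
    (.of_forall fun t => ?_)
  rw [norm_mul, norm_fourier_apply, one_mul]

theorem memLp_conj {f : T → ℂ} {q : ℝ≥0∞} (hf : MemLp f q m) :
    MemLp (fun t => conj (f t)) q m :=
  hf.of_le (Complex.continuous_conj.comp_aestronglyMeasurable hf.1)
    (.of_forall fun t => by rw [RCLike.norm_conj])

theorem inner_fourierBasis (f : L2) (n : ℤ) :
    inner ℂ (fourierBasis n : L2) f = fourierCoeff f n := by
  rw [← HilbertBasis.repr_apply_apply, fourierBasis_repr]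

/-- The Fourier coefficients of a product are given by convolution. -/
theorem hasSum_fourierCoeff_mul {a b : T → ℂ} (ha : MemLp a 2 m) (hb : MemLp b 2 m) (n : ℤ) :
    HasSum (fun k => fourierCoeff a k * fourierCoeff b (n - k))
      (fourierCoeff (fun t => a t * b t) n) := by
  -- The coefficient is the inner product of `conj a` with `z⁻ⁿ b`. Parseval then gives the
  -- convolution up to the reindexing `k ↦ -k`.
  have hx := memLp_conj ha
  have hy := memLp_fourier_mul (-n) hb
  have h := fourierBasis.hasSum_inner_mul_inner hx.toLp hy.toLp
  rw [← (Equiv.neg ℤ).hasSum_iff]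
  have hc : fourierCoeff (fun t => a t * b t) n = inner ℂ hx.toLp hy.toLp := by
    rw [L2.inner_def, fourierCoeff]
    refine integral_congr_ae ?_
    filter_upwards [hx.coeFn_toLp, hy.coeFn_toLp] with t h1 h2
    rw [h1, h2]
    simp only [RCLike.inner_apply, smul_eq_mul, Complex.conj_conj]
    ring
  rw [hc]
  refine h.congr_fun fun k => ?_
  rw [inner_fourierBasis, ← inner_conj_symm, inner_fourierBasis,
    fourierCoeff_congr_ae hx.coeFn_toLp, fourierCoeff_congr_ae hy.coeFn_toLp,
    fourierCoeff_conj, fourierCoeff_fourier_mul, Complex.conj_conj, Function.comp_apply,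
    Equiv.neg_apply, sub_neg_eq_add, sub_neg_eq_add, add_comm k n]

/-- Products of functions whose spectra are bounded below. -/
theorem fourierCoeff_mul_eq_zero {a b : T → ℂ} (ha : MemLp a 2 m) (hb : MemLp b 2 m) {i j : ℤ}
    (hai : ∀ n < i, fourierCoeff a n = 0) (hbj : ∀ n < j, fourierCoeff b n = 0) (n : ℤ)
    (hn : n < i + j) : fourierCoeff (fun t => a t * b t) n = 0 := by
  refine (hasSum_fourierCoeff_mul ha hb n).unique ?_
  convert hasSum_zero with k
  rcases lt_or_ge k i with h | h
  · rw [hai k h, zero_mul]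
  · rw [hbj (n - k) (by omega), mul_zero]

/-- The Fourier coefficients of a product of functions in `H²` form the Cauchy product. -/
theorem fourierCoeff_mul_eq_sum_range {a b : T → ℂ} (ha : MemLp a 2 m) (hb : MemLp b 2 m)
    (hai : ∀ n < 0, fourierCoeff a n = 0) (hbj : ∀ n < 0, fourierCoeff b n = 0) (n : ℕ) :
    fourierCoeff (fun t => a t * b t) n =
      ∑ k ∈ Finset.range (n + 1), fourierCoeff a k * fourierCoeff b ((n - k : ℕ) : ℤ) := by
  refine (hasSum_fourierCoeff_mul ha hb n).unique ?_
  have h : ∑ k ∈ Finset.range (n + 1), fourierCoeff a k * fourierCoeff b ((n - k : ℕ) : ℤ) =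
      ∑ k ∈ (Finset.range (n + 1)).map Nat.castEmbedding,
        fourierCoeff a k * fourierCoeff b ((n : ℤ) - k) := by
    rw [Finset.sum_map]
    refine Finset.sum_congr rfl fun k hk => ?_
    rw [Nat.castEmbedding_apply, Nat.cast_sub (by simpa [Nat.lt_succ_iff] using hk)]
  rw [h]
  refine hasSum_sum_of_ne_finset_zero fun k hk => ?_
  rcases lt_or_ge k 0 with h0 | h0
  · rw [hai k h0, zero_mul]
  · lift k to ℕ using h0
    rw [hbj, mul_zero]
    have : ¬ k < n + 1 := by simpa using hk
    omega

theorem norm_sq_eq_integral (f : L2) : ‖f‖ ^ 2 = ∫ t, ‖f t‖ ^ 2 ∂m := by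
  have h := congr_arg RCLike.re (@L2.inner_def T ℂ ℂ _ _ _ _ _ f f)
  rw [← integral_re] at h
  · simpa only [← norm_sq_eq_re_inner] using h
  · exact L2.integrable_inner f f

theorem hasSum_norm_sq_fourierCoeff (f : L2) :
    HasSum (fun n => ‖fourierCoeff f n‖ ^ 2) (‖f‖ ^ 2) := by
  rw [norm_sq_eq_integral]
  exact hasSum_sq_fourierCoeff f

end FourierCoefficients

/-! ### Boundary functions of bounded power series in the disc -/

section BoundedPowerSeries

theorem fourierCoeff_sub (f g : L2) (n : ℤ) :
    fourierCoeff (f - g : L2) n = fourierCoeff f n - fourierCoeff g n := by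
  rw [← inner_fourierBasis, inner_sub_right, inner_fourierBasis, inner_fourierBasis]

theorem fourierCoeff_fourierBasis (k n : ℤ) :
    fourierCoeff (fourierBasis k : L2) n = if n = k then 1 else 0 := by
  rw [← inner_fourierBasis]
  exact orthonormal_iff_ite.mp fourierBasis.orthonormal n k

theorem norm_le_of_ae_norm_le {f : L2} {M : ℝ} (hM : 0 ≤ M) (h : ∀ᵐ t ∂m, ‖f t‖ ≤ M) :
    ‖f‖ ≤ M := by
  simpa [measureUnivNNReal] using Lp.norm_le_of_ae_bound hM h

theorem sum_norm_sq_le {f : L2} {M : ℝ} (hM : ‖f‖ ≤ M) (s : Finset ℤ) :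
    ∑ n ∈ s, ‖fourierCoeff f n‖ ^ 2 ≤ M ^ 2 :=
  (sum_le_hasSum s (fun _ _ => by positivity) (hasSum_norm_sq_fourierCoeff f)).trans
    (by gcongr)

variable {a : ℕ → ℂ} {G : ℂ → ℂ} {M : ℝ}

/-- The restriction of a power series to the circle of radius `r < 1`. -/
theorem exists_dilation (hG : ∀ z : ℂ, ‖z‖ < 1 → HasSum (fun n => a n * z ^ n) (G z))
    (hM : ∀ z : ℂ, ‖z‖ < 1 → ‖G z‖ ≤ M) {r : ℝ} (h0 : 0 ≤ r) (h1 : r < 1) :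
    ∃ f : L2, (∀ᵐ t ∂m, ‖f t‖ ≤ M) ∧ (∀ n < 0, fourierCoeff f n = 0) ∧
      ∀ n : ℕ, fourierCoeff f n = a n * (r : ℂ) ^ n := by
  have hr : ‖(r : ℂ)‖ < 1 := by rwa [Complex.norm_real, Real.norm_of_nonneg h0]
  have hs : Summable fun n : ℕ => (a n * (r : ℂ) ^ n) • (fourier (n : ℤ) : C(T, ℂ)) := by
    refine Summable.of_norm ?_
    refine (hG r hr).summable.norm.congr fun n => ?_
    rw [norm_smul, fourier_norm, mul_one]
  obtain ⟨g, hg⟩ := hs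
  have hgt (t : T) : g t = G (r * coord t) := by
    have h := (ContinuousMap.evalCLM ℂ t).hasSum hg
    refine h.unique ?_
    refine (hG (r * coord t) ?_).congr_fun fun n => ?_
    · rwa [norm_mul, norm_coord, mul_one]
    · simp only [ContinuousMap.evalCLM_apply, ContinuousMap.smul_apply,
        smul_eq_mul]
      rw [← coord_pow, mul_pow]
      ring
  have hL : HasSum (fun n : ℕ => (a n * (r : ℂ) ^ n) • (fourierBasis (n : ℤ) : L2))
      (ContinuousMap.toLp 2 m ℂ g) := by
    refine ((ContinuousMap.toLp (E := ℂ) 2 m ℂ).hasSum hg).congr_fun fun n => ?_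
    simp only [map_smul, coe_fourierBasis]
  have hc (k : ℤ) : HasSum (fun n : ℕ => (a n * (r : ℂ) ^ n) * if k = n then 1 else 0)
      (fourierCoeff (ContinuousMap.toLp (E := ℂ) 2 m ℂ g) k) := by
    rw [← inner_fourierBasis]
    refine ((innerSL ℂ (fourierBasis k : L2)).hasSum hL).congr_fun fun n => ?_
    simp only [map_smul, innerSL_apply_apply, smul_eq_mul]
    rw [inner_fourierBasis, fourierCoeff_fourierBasis]
  refine ⟨ContinuousMap.toLp 2 m ℂ g, ?_, fun n hn => ?_, fun n => ?_⟩
  · filter_upwards [ContinuousMap.coeFn_toLp (p := 2) (𝕜 := ℂ) m g] with t ht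
    rw [ht, hgt]
    exact hM _ (by rwa [norm_mul, norm_coord, mul_one])
  · refine (hc n).unique ?_
    convert! hasSum_zero with k
    rw [if_neg (by omega), mul_zero]
  · refine (hc n).unique ?_
    convert! hasSum_ite_eq n (a n * (r : ℂ) ^ n) using 2 with k
    by_cases h : k = n
    · simp [h]
    · rw [if_neg h, if_neg (by omega), mul_zero]

/-- Bessel's inequality on the circle of radius `r < 1`, then `r → 1` in a finite sum. -/
theorem sum_norm_sq_coeff_le (hG : ∀ z : ℂ, ‖z‖ < 1 → HasSum (fun n => a n * z ^ n) (G z))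
    (hM : ∀ z : ℂ, ‖z‖ < 1 → ‖G z‖ ≤ M) (s : Finset ℕ) :
    ∑ n ∈ s, ‖a n‖ ^ 2 ≤ M ^ 2 := by
  have hM0 : 0 ≤ M := (norm_nonneg _).trans (hM 0 (by simp))
  have hlim : Tendsto (fun r : ℝ => ∑ n ∈ s, ‖a n * (r : ℂ) ^ n‖ ^ 2) (𝓝[<] 1)
      (𝓝 (∑ n ∈ s, ‖a n * ((1 : ℝ) : ℂ) ^ n‖ ^ 2)) := by
    refine Tendsto.mono_left (Continuous.tendsto ?_ 1) nhdsWithin_le_nhds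
    fun_prop
  simp only [Complex.ofReal_one, one_pow, mul_one] at hlim
  refine le_of_tendsto hlim ?_
  filter_upwards [Ioo_mem_nhdsLT (zero_lt_one' ℝ)] with r hr
  obtain ⟨f, hf, -, hfn⟩ := exists_dilation hG hM hr.1.le hr.2
  have h := sum_norm_sq_le (norm_le_of_ae_norm_le hM0 hf) (s.map Nat.castEmbedding)
  rw [Finset.sum_map] at h
  simpa only [Nat.castEmbedding_apply, hfn] using h

/-- Transfers a sup bound in the disc to the boundary `L²` norm through the coefficients alone, with
no radial limits. -/
theorem norm_le_of_hasSum_fourierCoeff {f : L2} (hf : f ∈ H2)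
    (hG : ∀ z : ℂ, ‖z‖ < 1 → HasSum (fun n : ℕ => fourierCoeff f n * z ^ n) (G z))
    (hM : ∀ z : ℂ, ‖z‖ < 1 → ‖G z‖ ≤ M) : ‖f‖ ≤ M := by
  have hM0 : 0 ≤ M := (norm_nonneg _).trans (hM 0 (by simp))
  refine le_of_sq_le_sq ?_ hM0
  have h := hasSum_norm_sq_fourierCoeff f
  rw [← Nat.cast_injective.hasSum_iff] at h
  · exact hasSum_le_of_sum_le h (sum_norm_sq_coeff_le hG hM)
  · intro n hn
    rw [hf n (by simpa using hn), norm_zero, zero_pow two_ne_zero]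

/-- A bounded power series in the disc has a bounded boundary function. -/
theorem exists_LInf_of_bounded (hG : ∀ z : ℂ, ‖z‖ < 1 → HasSum (fun n => a n * z ^ n) (G z))
    (hM : ∀ z : ℂ, ‖z‖ < 1 → ‖G z‖ ≤ M) :
    ∃ q : LInf, (∀ n < 0, fourierCoeff q n = 0) ∧ ∀ n : ℕ, fourierCoeff q n = a n := by
  let b : ℤ → ℂ := fun n => if n < 0 then 0 else a n.toNat
  have hbn (n : ℕ) : b n = a n := by
    simp only [b]
    rw [if_neg (by omega), Int.toNat_natCast]
  have hb : Summable fun n => ‖b n‖ ^ 2 := by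
    rw [← Nat.cast_injective.summable_iff]
    · exact summable_of_sum_le (fun _ => sq_nonneg _)
        (fun s => by simpa only [Function.comp_apply, hbn] using sum_norm_sq_coeff_le hG hM s)
    · intro n hn
      have : n < 0 := by simpa using hn
      simp [b, this]
  have hbm : Memℓp b 2 := memℓp_gen (by simpa using hb)
  obtain ⟨f, hf⟩ : ∃ f : L2, ∀ n, fourierCoeff f n = b n :=
    ⟨fourierBasis.repr.symm ⟨b, hbm⟩, fun n => by
      rw [← fourierBasis_repr, LinearIsometryEquiv.apply_symm_apply]⟩
  let r : ℕ → ℝ := fun k => 1 - 1 / (k + 1 : ℝ)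
  have hr0 (k : ℕ) : 0 ≤ r k := by
    have : 1 / (k + 1 : ℝ) ≤ 1 := (div_le_one (by positivity)).mpr (by simp)
    simp only [r]
    linarith
  have hr1 (k : ℕ) : r k < 1 := by
    have : 0 < 1 / (k + 1 : ℝ) := by positivity
    simp only [r]
    linarith
  have hrlim : Tendsto r atTop (𝓝 1) := by
    simpa [r] using tendsto_one_div_add_atTop_nhds_zero_nat (𝕜 := ℝ).const_sub 1
  choose F hFM hFneg hF using fun k => exists_dilation hG hM (hr0 k) (hr1 k)
  have hcoef (k : ℕ) (n : ℤ) :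
      ‖fourierCoeff (F k - f : L2) n‖ ^ 2 = ‖b n * ((r k : ℂ) ^ n.toNat - 1)‖ ^ 2 := by
    rw [fourierCoeff_sub, hf]
    rcases lt_or_ge n 0 with h | h
    · simp [hFneg k n h, b, h]
    · lift n to ℕ using h
      rw [hF, hbn, Int.toNat_natCast, mul_sub, mul_one]
  -- By Parseval the squared distance is a sum over `n`, dominated by the summable `‖b n‖²` and
  -- tending to zero termwise.
  have hconv : Tendsto (fun k => ‖F k - f‖ ^ 2) atTop (𝓝 0) := by
    have h := tendsto_tsum_of_dominated_convergence (𝓕 := atTop)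
      (f := fun k n => ‖b n * ((r k : ℂ) ^ n.toNat - 1)‖ ^ 2) (g := fun _ => (0 : ℝ))
      (bound := fun n => ‖b n‖ ^ 2) hb (fun n => ?_) (.of_forall fun k n => ?_)
    · rw [tsum_zero] at h
      refine h.congr fun k => ?_
      rw [← (hasSum_norm_sq_fourierCoeff (F k - f)).tsum_eq]
      exact tsum_congr fun n => (hcoef k n).symm
    · have : Tendsto (fun k => ‖b n * ((r k : ℂ) ^ n.toNat - 1)‖ ^ 2) atTop
          (𝓝 (‖b n * (((1 : ℝ) : ℂ) ^ n.toNat - 1)‖ ^ 2)) := by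
        refine Tendsto.comp (g := fun x : ℝ => ‖b n * ((x : ℂ) ^ n.toNat - 1)‖ ^ 2)
          (Continuous.tendsto (by fun_prop) 1) hrlim
      simpa using this
    · rw [Real.norm_of_nonneg (by positivity), norm_mul]
      have h : ‖(r k : ℂ) ^ n.toNat - 1‖ ≤ 1 := by
        rw [← Complex.ofReal_pow, ← Complex.ofReal_one, ← Complex.ofReal_sub, Complex.norm_real,
          Real.norm_eq_abs, abs_le]
        have h1 := pow_nonneg (hr0 k) n.toNat
        have h2 := pow_le_one₀ (n := n.toNat) (hr0 k) (hr1 k).le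
        constructor <;> linarith
      gcongr
      exact mul_le_of_le_one_right (norm_nonneg _) h
  have hFf : Tendsto F atTop (𝓝 f) := by
    rw [tendsto_iff_norm_sub_tendsto_zero]
    simpa using hconv.sqrt
  -- `L²` convergence gives an a.e. convergent subsequence, along which the uniform bound `M` passes
  -- to `f`.
  obtain ⟨ns, -, hns⟩ := (tendstoInMeasure_of_tendsto_Lp hFf).exists_seq_tendsto_ae
  have hfM : ∀ᵐ t ∂m, ‖f t‖ ≤ M := by
    filter_upwards [hns, ae_all_iff.mpr hFM] with t ht hb
    exact le_of_tendsto ht.norm (.of_forall fun k => hb _)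
  have hq : MemLp f ∞ m := memLp_top_of_bound (Lp.aestronglyMeasurable f) M hfM
  refine ⟨hq.toLp, fun n hn => ?_, fun n => ?_⟩
  · rw [fourierCoeff_congr_ae hq.coeFn_toLp, hf]
    simp [b, hn]
  · rw [fourierCoeff_congr_ae hq.coeFn_toLp, hf, hbn]

end BoundedPowerSeries

/-! ### The Herglotz integral: positivity, power series, exponential -/

section Herglotz

/-- The Herglotz integral of a real function on the circle. -/
noncomputable def herglotz (φ : T → ℝ) (z : ℂ) : ℂ :=
  ∫ t, (coord t + z) / (coord t - z) * (φ t : ℂ) ∂m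

theorem coord_sub_ne_zero {z : ℂ} (hz : ‖z‖ < 1) (t : T) : coord t - z ≠ 0 := by
  intro h
  rw [sub_eq_zero] at h
  rw [← h, norm_coord] at hz
  exact hz.false

theorem continuous_herglotzKernel {z : ℂ} (hz : ‖z‖ < 1) :
    Continuous fun t => (coord t + z) / (coord t - z) :=
  (continuous_coord.add continuous_const).div (continuous_coord.sub continuous_const)
    (coord_sub_ne_zero hz)

theorem integrable_herglotz {φ : T → ℝ} (hφ : Integrable φ m) {z : ℂ} (hz : ‖z‖ < 1) :
    Integrable (fun t => (coord t + z) / (coord t - z) * (φ t : ℂ)) m := by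
  obtain ⟨C, hC⟩ := isCompact_univ.exists_bound_of_continuousOn
    (continuous_herglotzKernel hz).continuousOn
  exact hφ.ofReal.bdd_mul (continuous_herglotzKernel hz).aestronglyMeasurable
    (.of_forall fun t => hC t (Set.mem_univ t))

theorem herglotz_add {φ ψ : T → ℝ} (hφ : Integrable φ m) (hψ : Integrable ψ m) {z : ℂ}
    (hz : ‖z‖ < 1) : herglotz φ z + herglotz ψ z = herglotz (fun t => φ t + ψ t) z := by
  rw [herglotz, herglotz, herglotz,
    ← integral_add (integrable_herglotz hφ hz) (integrable_herglotz hψ hz)]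
  refine integral_congr_ae (.of_forall fun t => ?_)
  simp only [Complex.ofReal_add]
  ring

theorem herglotz_zero (φ : T → ℝ) : herglotz φ 0 = ((∫ t, φ t ∂m : ℝ) : ℂ) := by
  rw [herglotz, ← integral_complex_ofReal]
  refine integral_congr_ae (.of_forall fun t => ?_)
  have h := coord_sub_ne_zero (z := 0) (by simp) t
  simp only [sub_zero] at h
  simp only [add_zero, sub_zero, div_self h, one_mul]

theorem re_herglotzKernel_nonneg {z : ℂ} (hz : ‖z‖ < 1) (t : T) :
    0 ≤ ((coord t + z) / (coord t - z)).re := by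
  rw [Complex.div_re, ← add_div]
  refine div_nonneg ?_ (Complex.normSq_nonneg _)
  have h1 : Complex.normSq (coord t) = 1 := by rw [Complex.normSq_eq_norm_sq, norm_coord, one_pow]
  have h2 : Complex.normSq z ≤ 1 := by
    rw [Complex.normSq_eq_norm_sq]
    exact pow_le_one₀ (norm_nonneg z) hz.le
  rw [Complex.normSq_apply] at h1 h2
  simp only [Complex.add_re, Complex.add_im, Complex.sub_re, Complex.sub_im]
  linarith

/-- The real part is the Poisson integral, whose kernel is nonnegative; so pointwise bounds on
boundary data bound `|exp|` of the Herglotz integral. -/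
theorem re_herglotz_mono {φ ψ : T → ℝ} (hφ : Integrable φ m) (hψ : Integrable ψ m)
    (h : ∀ t, φ t ≤ ψ t) {z : ℂ} (hz : ‖z‖ < 1) : (herglotz φ z).re ≤ (herglotz ψ z).re := by
  have hr {χ : T → ℝ} (hχ : Integrable χ m) :
      (herglotz χ z).re = ∫ t, ((coord t + z) / (coord t - z)).re * χ t ∂m := by
    have := integral_re (𝕜 := ℂ) (integrable_herglotz hχ hz)
    simp only [RCLike.re_eq_complex_re] at this
    rw [herglotz, ← this]
    exact integral_congr_ae (.of_forall fun t => Complex.re_mul_ofReal _ _)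
  have hi {χ : T → ℝ} (hχ : Integrable χ m) :
      Integrable (fun t => ((coord t + z) / (coord t - z)).re * χ t) m :=
    (integrable_herglotz hχ hz).re.congr (.of_forall fun t => Complex.re_mul_ofReal _ _)
  rw [hr hφ, hr hψ]
  exact integral_mono (hi hφ) (hi hψ)
    fun t => mul_le_mul_of_nonneg_left (h t) (re_herglotzKernel_nonneg hz t)

theorem hasSum_herglotzKernel {z : ℂ} (hz : ‖z‖ < 1) (t : T) :
    HasSum (fun n : ℕ => (if n = 0 then 1 else 2) * (fourier (-n : ℤ) t * z ^ n))
      ((coord t + z) / (coord t - z)) := by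
  have hw : ‖fourier (-1 : ℤ) t * z‖ < 1 := by rwa [norm_mul, norm_fourier_apply, one_mul]
  have hc : coord t * fourier (-1 : ℤ) t = 1 := by
    rw [coord, ← fourier_add, add_neg_cancel, fourier_zero]
  have hpow (n : ℕ) : (fourier (-1 : ℤ) t * z) ^ n = fourier (-n : ℤ) t * z ^ n := by
    rw [mul_pow, fourier_neg (n := (n : ℤ)), ← coord_pow, coord, map_pow, fourier_neg]
  have h := ((hasSum_geometric_of_norm_lt_one hw).mul_left 2).sub
    (hasSum_ite_eq (0 : ℕ) (1 : ℂ))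
  -- With `|ζ| = 1` the kernel is `2/(1 - z/ζ) - 1`, a geometric series; the `-1` halves its
  -- constant term.
  have hv : 2 * (1 - fourier (-1 : ℤ) t * z)⁻¹ - 1 = (coord t + z) / (coord t - z) := by
    have h1 := coord_sub_ne_zero hz t
    have h2 : coord t - z = coord t * (1 - fourier (-1 : ℤ) t * z) := by
      linear_combination z * hc
    have h3 : 1 - fourier (-1 : ℤ) t * z ≠ 0 := right_ne_zero_of_mul (h2 ▸ h1)
    rw [eq_div_iff h1]
    nth_rw 1 [h2]
    have h4 := inv_mul_cancel₀ h3
    linear_combination 2 * coord t * h4 + z * hc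
  rw [hv] at h
  refine h.congr_fun fun n => ?_
  rw [← hpow]
  rcases eq_or_ne n 0 with rfl | hn
  · norm_num
  · simp [hn]

/-- The Herglotz integral as a power series. -/
theorem hasSum_herglotz {φ : T → ℝ} (hφ : Integrable φ m) {z : ℂ} (hz : ‖z‖ < 1) :
    HasSum (fun n : ℕ => (if n = 0 then 1 else 2) * fourierCoeff (fun t => (φ t : ℂ)) n * z ^ n)
      (herglotz φ z) := by
  let F : ℕ → T → ℂ := fun n t =>
    (if n = 0 then 1 else 2) * z ^ n * (fourier (-n : ℤ) t • (φ t : ℂ))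
  have hn (n : ℕ) (t : T) : ‖F n t‖ = ‖(if n = 0 then 1 else 2 : ℂ) * z ^ n‖ * ‖φ t‖ := by
    rw [norm_mul, norm_smul, norm_fourier_apply, one_mul, Complex.norm_real]
  have hi (n : ℕ) : Integrable (F n) m := (hφ.ofReal.fourier_smul _).const_mul _
  have hs : Summable fun n => ∫ t, ‖F n t‖ ∂m := by
    simp_rw [hn, integral_const_mul]
    refine Summable.mul_right _ ?_
    refine Summable.of_nonneg_of_le (fun _ => norm_nonneg _) (fun n => ?_)
      ((summable_geometric_of_lt_one (norm_nonneg z) hz).mul_left 2)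
    rw [norm_mul, norm_pow]
    gcongr
    split_ifs <;> norm_num
  have h := hasSum_integral_of_summable_integral_norm hi hs
  have hv : ∫ t, ∑' n, F n t ∂m = herglotz φ z := by
    refine integral_congr_ae (.of_forall fun t => HasSum.tsum_eq ?_)
    refine ((hasSum_herglotzKernel hz t).mul_right (φ t : ℂ)).congr_fun fun n => ?_
    simp only [F, smul_eq_mul]
    ring
  rw [hv] at h
  refine h.congr_fun fun n => ?_
  simp only [F, integral_const_mul]
  rw [fourierCoeff]
  ring

theorem herglotz_const (c : ℝ) {z : ℂ} (hz : ‖z‖ < 1) : herglotz (fun _ => c) z = c := by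
  refine (hasSum_herglotz (integrable_const c) hz).unique ?_
  have h (n : ℕ) : fourierCoeff (fun _ : T => (c : ℂ)) n = if n = 0 then (c : ℂ) else 0 := by
    have h1 : (fun _ : T => (c : ℂ)) = fun t => (c : ℂ) * (fourier (0 : ℤ) t : ℂ) := by
      ext t
      rw [fourier_zero, mul_one]
    have h2 : (fourierBasis (0 : ℤ) : L2) =ᵐ[m] fourier 0 := by
      rw [coe_fourierBasis]
      exact coeFn_fourierLp 2 0
    rw [h1, fourierCoeff.const_mul, ← fourierCoeff_congr_ae h2, fourierCoeff_fourierBasis]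
    simp
  convert! hasSum_ite_eq (0 : ℕ) (c : ℂ) using 2 with n
  rw [h]
  split_ifs with h0
  · simp [h0]
  · simp

/-- `exp` of a power series converging in the disc is again such a power series. -/
theorem exists_hasSum_exp {c : ℕ → ℂ} {H : ℂ → ℂ}
    (hH : ∀ z : ℂ, ‖z‖ < 1 → HasSum (fun n => c n * z ^ n) (H z)) :
    ∃ a : ℕ → ℂ, ∀ z : ℂ, ‖z‖ < 1 → HasSum (fun n => a n * z ^ n) (Complex.exp (H z)) := by
  have hd : DifferentiableOn ℂ H (Metric.ball 0 1) := by
    intro z hz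
    rw [mem_ball_zero_iff] at hz
    -- Absolute convergence at the intermediate radius `r` dominates the series uniformly on the
    -- smaller disc.
    obtain ⟨r, hr, hr1⟩ := exists_between hz
    have hr0 : 0 ≤ r := (norm_nonneg z).trans hr.le
    have hrn : ‖(r : ℂ)‖ = r := by rw [Complex.norm_real, Real.norm_of_nonneg hr0]
    have hdr : DifferentiableOn ℂ (fun w => ∑' n, c n * w ^ n) (Metric.ball 0 r) := by
      refine Complex.differentiableOn_tsum_of_summable_norm
        (hH r (by rwa [hrn])).summable.norm (fun n => by fun_prop) Metric.isOpen_ball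
        fun n w hw => ?_
      rw [mem_ball_zero_iff] at hw
      rw [norm_mul, norm_mul, norm_pow, norm_pow, hrn]
      gcongr
    have hzr : Metric.ball (0 : ℂ) r ∈ 𝓝 z := Metric.isOpen_ball.mem_nhds (by simpa using hr)
    refine DifferentiableAt.differentiableWithinAt ?_
    refine (hdr.differentiableAt hzr).congr_of_eventuallyEq ?_
    filter_upwards [hzr] with w hw
    rw [mem_ball_zero_iff] at hw
    exact (hH w (hw.trans hr1)).tsum_eq.symm
  refine ⟨fun n => (n.factorial : ℂ)⁻¹ * iteratedDeriv n (fun z => Complex.exp (H z)) 0,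
    fun z hz => ?_⟩
  refine (Complex.hasSum_taylorSeries_on_ball hd.cexp (z := z) (by simpa using hz)).congr_fun
    fun n => ?_
  simp only [sub_zero, smul_eq_mul]
  ring

end Herglotz

/-! ### Cyclicity of outer functions -/

section Outer

/-- Multiplication on the circle corresponds to multiplication of the analytic extensions, by the
Cauchy product. -/
theorem hasSum_fourierCoeff_mulOp {q : LInf} {p : L2} (hp : p ∈ H2)
    (hq : ∀ n < 0, fourierCoeff q n = 0) {P Q z : ℂ}
    (hP : HasSum (fun n : ℕ => fourierCoeff p n * z ^ n) P)
    (hQ : HasSum (fun n : ℕ => fourierCoeff q n * z ^ n) Q) :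
    HasSum (fun n : ℕ => fourierCoeff (mulOp q p) n * z ^ n) (Q * P) := by
  have h := hasSum_sum_range_mul_of_summable_norm hQ.summable.norm hP.summable.norm
  rw [hQ.tsum_eq, hP.tsum_eq] at h
  refine h.congr_fun fun n => ?_
  rw [fourierCoeff_congr_ae (coeFn_mulOp q p), fourierCoeff_mul_eq_sum_range
    ((Lp.memLp q).mono_exponent le_top) (Lp.memLp p) hq hp, Finset.sum_mul]
  refine Finset.sum_congr rfl fun k hk => ?_
  have hk' : k ≤ n := by simpa [Nat.lt_succ_iff] using hk
  rw [← Nat.add_sub_of_le hk', Nat.add_sub_cancel_left, pow_add]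
  ring

theorem mulOp_mem_H2 {q : LInf} {p : L2} (hp : p ∈ H2) (hq : ∀ n < 0, fourierCoeff q n = 0) :
    mulOp q p ∈ H2 := by
  intro n hn
  rw [fourierCoeff_congr_ae (coeFn_mulOp q p)]
  exact fourierCoeff_mul_eq_zero ((Lp.memLp q).mono_exponent le_top) (Lp.memLp p) hq hp n
    (by simpa using hn)

/-- Outer functions are cyclic: the constant `1` is a limit of multiples by `H^∞` functions. -/
theorem IsOuter.exists_tendsto {p : L2} (hp : IsOuter p) :
    ∃ q : ℕ → LInf, (∀ k, ∀ n < 0, fourierCoeff (q k) n = 0) ∧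
      Tendsto (fun k => mulOp (q k) p) atTop (𝓝 (fourierBasis (0 : ℤ))) := by
  obtain ⟨hpH, φ, hφ, hpφ⟩ := hp
  change ∀ z : ℂ, ‖z‖ < 1 → HasSum _ (Complex.exp (herglotz φ z)) at hpφ
  -- `exp (herglotz (ψ k))` is `1/p` truncated so that its modulus is at most `eᵏ`. Its product with
  -- `p` has boundary data `ψ k + φ = min(0, φ + k) ≤ 0`, hence is bounded by `1`.
  let ψ : ℕ → T → ℝ := fun k t => -max (φ t) (-k)
  have hψ (k : ℕ) : Integrable (ψ k) m := (hφ.sup (integrable_const _)).neg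
  have hψk (k : ℕ) (z : ℂ) (hz : ‖z‖ < 1) : ‖Complex.exp (herglotz (ψ k) z)‖ ≤ Real.exp k := by
    rw [Complex.norm_exp, Real.exp_le_exp]
    refine (re_herglotz_mono (hψ k) (integrable_const (k : ℝ)) (fun t => ?_) hz).trans_eq ?_
    · exact neg_le.mp (le_max_right _ _)
    · rw [herglotz_const _ hz, Complex.ofReal_re]
  have hex (k : ℕ) : ∃ q : LInf, (∀ n < 0, fourierCoeff q n = 0) ∧ ∀ z : ℂ, ‖z‖ < 1 →
      HasSum (fun n : ℕ => fourierCoeff q n * z ^ n) (Complex.exp (herglotz (ψ k) z)) := by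
    obtain ⟨a, ha⟩ := exists_hasSum_exp fun z hz => hasSum_herglotz (hψ k) hz
    obtain ⟨q, hq, hqa⟩ := exists_LInf_of_bounded ha (hψk k)
    exact ⟨q, hq, fun z hz => by simpa only [hqa] using ha z hz⟩
  choose q hq hqs using hex
  have hsum (k : ℕ) (z : ℂ) (hz : ‖z‖ < 1) :
      HasSum (fun n : ℕ => fourierCoeff (mulOp (q k) p) n * z ^ n)
        (Complex.exp (herglotz (fun t => ψ k t + φ t) z)) := by
    rw [← herglotz_add (hψ k) hφ hz, Complex.exp_add]
    exact hasSum_fourierCoeff_mulOp hpH (hq k) (hpφ z hz) (hqs k z hz)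
  have hnorm (k : ℕ) : ‖mulOp (q k) p‖ ≤ 1 := by
    refine norm_le_of_hasSum_fourierCoeff (mulOp_mem_H2 hpH (hq k)) (hsum k) fun z hz => ?_
    rw [Complex.norm_exp, Real.exp_le_one_iff]
    refine (re_herglotz_mono ((hψ k).add hφ) (integrable_const 0) (fun t => ?_) hz).trans_eq ?_
    · have := le_max_left (φ t) (-k)
      simp only [ψ, Pi.add_apply]
      linarith
    · rw [herglotz_const _ hz, Complex.ofReal_zero, Complex.zero_re]
  have hzero (k : ℕ) : fourierCoeff (mulOp (q k) p) 0 =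
      (Real.exp (∫ t, (ψ k t + φ t) ∂m) : ℝ) := by
    rw [Complex.ofReal_exp, ← herglotz_zero]
    refine HasSum.unique ?_ (hsum k 0 (by simp))
    convert! hasSum_ite_eq (0 : ℕ) (fourierCoeff (mulOp (q k) p) 0) using 2 with n
    rcases eq_or_ne n 0 with rfl | hn
    · simp
    · simp [hn]
  have hint : Tendsto (fun k : ℕ => ∫ t, (ψ k t + φ t) ∂m) atTop (𝓝 0) := by
    have h := tendsto_integral_of_dominated_convergence (μ := m)
      (F := fun (k : ℕ) t => ψ k t + φ t) (f := fun _ => (0 : ℝ)) (fun t => |φ t|)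
      (fun k => ((hψ k).add hφ).1) hφ.abs (fun k => .of_forall fun t => ?_)
      (.of_forall fun t => ?_)
    · simpa using h
    · have hk : (0 : ℝ) ≤ k := k.cast_nonneg
      rw [Real.norm_eq_abs]
      simp only [ψ]
      rcases max_cases (φ t) (-(k : ℝ)) with ⟨h, h'⟩ | ⟨h, h'⟩ <;> rw [h]
      · simp
      · rw [abs_of_nonpos (by linarith), abs_of_nonpos (by linarith)]
        linarith
    · refine tendsto_const_nhds.congr' ?_
      filter_upwards [eventually_ge_atTop ⌈-φ t⌉₊] with k hk
      have : -φ t ≤ k := Nat.ceil_le.mp hk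
      simp only [ψ]
      rw [max_eq_left (by linarith), neg_add_cancel]
  refine ⟨q, hq, ?_⟩
  rw [tendsto_iff_norm_sub_tendsto_zero]
  -- Expand the square: both norms are at most `1`, and the inner product with the constant `1` is
  -- the value at the origin, which tends to `1`.
  have hbound (k : ℕ) : ‖mulOp (q k) p - fourierBasis (0 : ℤ)‖ ^ 2 ≤
      2 - 2 * Real.exp (∫ t, (ψ k t + φ t) ∂m) := by
    rw [norm_sub_sq (𝕜 := ℂ), inner_re_symm, inner_fourierBasis, hzero,
      fourierBasis.orthonormal.1 0, RCLike.re_eq_complex_re, Complex.ofReal_re]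
    have := pow_le_one₀ (n := 2) (norm_nonneg _) (hnorm k)
    linarith
  have hlim : Tendsto (fun k => 2 - 2 * Real.exp (∫ t, (ψ k t + φ t) ∂m)) atTop (𝓝 0) := by
    simpa using ((Real.continuous_exp.tendsto _).comp hint).const_mul 2 |>.const_sub 2
  have hsq := squeeze_zero (fun _ => sq_nonneg _) hbound hlim
  simpa using hsq.sqrt

end Outer

/-! ### Description of the kernels, and minimality -/

section ToeplitzKernels

/-- `f ∈ ker T_g` iff `conj (conj Θ g f)` lies in `z H²`. -/
theorem mem_toeplitzKer_iff {Θ : InnerFunction} {g : LInf} {f : L2} :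
    f ∈ toeplitzKer H2 Θ.subspace g ↔ f ∈ H2 ∧
      ∀ n < 1, fourierCoeff (fun t => conj (conj (Θ.toLInf t) * (g t * f t))) n = 0 := by
  rw [mem_toeplitzKer]
  refine and_congr_right fun _ => ?_
  let w : L2 := mulOp (star Θ.toLInf) (mulOp g f)
  have hw : w =ᵐ[m] fun t => conj (Θ.toLInf t) * (g t * f t) := by
    filter_upwards [coeFn_mulOp (star Θ.toLInf) (mulOp g f), coeFn_mulOp g f,
      Lp.coeFn_star Θ.toLInf] with t h1 h2 h3
    rw [h1, h2, h3]
    rfl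
  have hinner (h : L2) : inner ℂ (mulOp Θ.toLInf h) (mulOp g f) = inner ℂ h w := by
    rw [L2.inner_def, L2.inner_def]
    refine integral_congr_ae ?_
    filter_upwards [coeFn_mulOp Θ.toLInf h, coeFn_mulOp g f, hw] with t h1 h2 h3
    rw [h1, h2, h3]
    simp only [RCLike.inner_apply, map_mul]
    ring
  -- Conjugation reflects the index, so `n < 1` corresponds to the coefficients of `w` of index `-n
  -- ≥ 0`, those seen by `H²`.
  have hcoef (n : ℤ) : fourierCoeff (fun t => conj (conj (Θ.toLInf t) * (g t * f t))) n =
      conj (fourierCoeff w (-n)) := by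
    rw [fourierCoeff_congr_ae hw, fourierCoeff_conj]
  have hmem : mulOp g f ∈ Θ.subspaceᗮ ↔ ∀ h ∈ H2, inner ℂ h w = 0 := by
    rw [Submodule.mem_orthogonal]
    constructor
    · intro H h hh
      rw [← hinner]
      exact H _ (Submodule.mem_map_of_mem hh)
    · rintro H - ⟨h, hh, rfl⟩
      exact (hinner h).trans (H h hh)
  rw [hmem]
  simp_rw [hcoef, map_eq_zero]
  constructor
  · intro H n hn
    rw [← inner_fourierBasis]
    refine H _ fun k hk => ?_
    rw [fourierCoeff_fourierBasis, if_neg (by omega)]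
  · intro H h hh
    refine (fourierBasis.hasSum_inner_mul_inner h w).unique ?_
    convert! hasSum_zero with n
    rcases lt_or_ge n 0 with hn | hn
    · rw [← inner_conj_symm, inner_fourierBasis, hh n hn, map_zero, zero_mul]
    · rw [inner_fourierBasis, ← neg_neg n, H (-n) (by omega), mul_zero]

theorem memLp_conj_mul_mul (Θ : InnerFunction) (g : LInf) (f : L2) :
    MemLp (fun t => conj (conj (Θ.toLInf t) * (g t * f t))) 2 m := by
  refine memLp_conj ((Lp.memLp (mulOp g f)).congr_norm ?_ ?_)
  · exact (Complex.continuous_conj.comp_aestronglyMeasurable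
      (Lp.aestronglyMeasurable Θ.toLInf)).mul
      ((Lp.aestronglyMeasurable g).mul (Lp.aestronglyMeasurable f))
  · filter_upwards [coeFn_mulOp g f, Θ.norm_eq_one] with t h1 h2
    rw [h1, norm_mul (conj _), RCLike.norm_conj, h2, one_mul]

theorem coeFn_symbol (Θ : InnerFunction) (p : L2) :
    symbol Θ p =ᵐ[m] fun t => Θ.toLInf t * conj (coord t * p t) / p t :=
  (memLp_symbol Θ p).coeFn_toLp

/-- The product of two functions in `L^∞`. -/
noncomputable def mulLInf (g h : LInf) : LInf := (ContinuousLinearMap.mul ℂ ℂ).holderL m ∞ ∞ ∞ g h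

theorem coeFn_mulLInf (g h : LInf) : mulLInf g h =ᵐ[m] fun t => g t * h t := by
  simpa [mulLInf] using (ContinuousLinearMap.mul ℂ ℂ).coeFn_holder (r := ∞) g h

theorem coeFn_mulLInf_star_symbol (Θ θ : InnerFunction) (p : L2) :
    mulLInf (star θ.toLInf) (symbol Θ p) =ᵐ[m]
      fun t => conj (θ.toLInf t) * (Θ.toLInf t * conj (coord t * p t) / p t) := by
  filter_upwards [coeFn_mulLInf (star θ.toLInf) (symbol Θ p), Lp.coeFn_star θ.toLInf,
    coeFn_symbol Θ p] with t h1 h2 h3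
  rw [h1, h2, h3]
  rfl

theorem conj_mul_self_of_norm_eq_one {w : ℂ} (hw : ‖w‖ = 1) : conj w * w = 1 := by
  rw [← Complex.normSq_eq_conj_mul_self, Complex.normSq_eq_norm_sq, hw]
  norm_num

/-- Along a subsequence `q_k p → 1` a.e., which is impossible where `p` vanishes. This makes the
division in `symbol` a genuine one. -/
theorem IsOuter.ae_ne_zero {p : L2} (hp : IsOuter p) : ∀ᵐ t ∂m, p t ≠ 0 := by
  obtain ⟨q, -, hlim⟩ := hp.exists_tendsto
  obtain ⟨ns, -, hns⟩ := (tendstoInMeasure_of_tendsto_Lp hlim).exists_seq_tendsto_ae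
  have h1 : (fourierBasis (0 : ℤ) : L2) =ᵐ[m] fourier 0 := by
    rw [coe_fourierBasis]
    exact coeFn_fourierLp 2 0
  filter_upwards [hns, h1, ae_all_iff.mpr fun k => coeFn_mulOp (q k) p] with t h2 h3 h4 h0
  simp_rw [h4, h0, mul_zero, h3, fourier_zero] at h2
  exact one_ne_zero (tendsto_nhds_unique h2 tendsto_const_nhds)

/-- Division by an outer function within `L²`: if `v p` is the product of `z⁻¹ w` and `h`, where
`w, h ∈ z H²`, then `v ∈ z H²`. -/
theorem IsOuter.fourierCoeff_eq_zero_of_mul {p : L2} (hp : IsOuter p) {v w h : T → ℂ}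
    (hv : MemLp v 2 m) (hw : MemLp w 2 m) (hh : MemLp h 2 m)
    (hwn : ∀ n < 1, fourierCoeff w n = 0) (hhn : ∀ n < 1, fourierCoeff h n = 0)
    (heq : ∀ᵐ t ∂m, coord t * (v t * p t) = w t * h t) :
    ∀ n < 1, fourierCoeff v n = 0 := by
  intro n hn
  obtain ⟨q, hq, hlim⟩ := hp.exists_tendsto
  let V : L2 := (memLp_conj (memLp_fourier_mul (-n) hv)).toLp
  have hV : V =ᵐ[m] fun t => conj (fourier (-n) t * v t) := MemLp.coeFn_toLp _
  have hinner (f : L2) : inner ℂ V f = fourierCoeff (fun t => v t * f t) n := by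
    rw [L2.inner_def, fourierCoeff]
    refine integral_congr_ae ?_
    filter_upwards [hV] with t ht
    rw [ht]
    simp only [RCLike.inner_apply, smul_eq_mul, Complex.conj_conj]
    ring
  have h0 (k : ℕ) : inner ℂ V (mulOp (q k) p) = 0 := by
    have hqL : MemLp (q k) 2 m := (Lp.memLp (q k)).mono_exponent le_top
    let hL : L2 := mulOp (q k) hh.toLp
    have hLe : hL =ᵐ[m] fun t => q k t * h t := by
      filter_upwards [coeFn_mulOp (q k) hh.toLp, hh.coeFn_toLp] with t h1 h2
      rw [h1, h2]
    have hLn : ∀ j < 1, fourierCoeff hL j = 0 := fun j hj => by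
      rw [fourierCoeff_congr_ae hLe]
      exact fourierCoeff_mul_eq_zero hqL hh (hq k) hhn j (by simpa using hj)
    -- Both `w` and `q_k h` have spectrum in `[1, ∞)`, so their product starts at `2`; removing the
    -- factor `z` in `heq` leaves `1`.
    have hprod := fourierCoeff_mul_eq_zero hw (Lp.memLp hL) hwn hLn (n + 1) (by omega)
    rw [hinner, ← hprod, ← add_sub_cancel_right n 1, ← fourierCoeff_fourier_mul,
      add_sub_cancel_right]
    refine congr_fun (fourierCoeff_congr_ae ?_) _
    filter_upwards [heq, hLe, coeFn_mulOp (q k) p] with t h1 h2 h3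
    rw [h2, h3]
    change coord t * _ = _
    linear_combination q k t * h1
  have hlim' : Tendsto (fun k => inner ℂ V (mulOp (q k) p)) atTop
      (𝓝 (inner ℂ V (fourierBasis (0 : ℤ) : L2))) := tendsto_const_nhds.inner hlim
  simp_rw [h0] at hlim'
  rw [tendsto_nhds_unique tendsto_const_nhds hlim', ← inner_conj_symm, inner_fourierBasis,
    fourierCoeff_congr_ae hV, fourierCoeff_conj, fourierCoeff_fourier_mul, Complex.conj_conj]
  simp

/-- The minimal kernel of `θ p`. -/
theorem isMinKernel_mulLInf_symbol (Θ θ : InnerFunction) {p : L2} (hp : IsOuter p) :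
    IsMinKernel H2 Θ.subspace (mulOp θ.toLInf p)
      (toeplitzKer H2 Θ.subspace (mulLInf (star θ.toLInf) (symbol Θ p))) := by
  refine ⟨⟨_, rfl, ?_⟩, ?_⟩
  · rw [mem_toeplitzKer_iff]
    refine ⟨mulOp_mem_H2 hp.1 θ.fourierCoeff_neg, fun n hn => ?_⟩
    have h : (fun t => conj (conj (Θ.toLInf t) *
        (mulLInf (star θ.toLInf) (symbol Θ p) t * mulOp θ.toLInf p t))) =ᵐ[m]
        fun t => fourier 1 t * p t := by
      filter_upwards [coeFn_mulLInf_star_symbol Θ θ p, coeFn_mulOp θ.toLInf p, hp.ae_ne_zero,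
        Θ.norm_eq_one, θ.norm_eq_one] with t h1 h2 h3 h4 h5
      have h4 := conj_mul_self_of_norm_eq_one h4
      have h5 := conj_mul_self_of_norm_eq_one h5
      rw [h1, h2]
      have : conj (Θ.toLInf t) * (conj (θ.toLInf t) * (Θ.toLInf t * conj (coord t * p t) / p t) *
          (θ.toLInf t * p t)) = conj (coord t * p t) := by
        field_simp
        linear_combination conj (coord t * p t) *
          (conj (θ.toLInf t) * θ.toLInf t * h4 + h5)
      rw [this, Complex.conj_conj]
      rfl
    rw [fourierCoeff_congr_ae h, fourierCoeff_fourier_mul]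
    exact hp.1 _ (by omega)
  · rintro N ⟨g, rfl, hk⟩ f hf
    -- The factor `w` comes from `θp` in the kernel of `g`, the factor `h` from `f` in the kernel of
    -- the explicit symbol; the unimodular factors and `conj p` cancel in `w h`.
    rw [mem_toeplitzKer_iff] at hf hk ⊢
    refine ⟨hf.1, hp.fourierCoeff_eq_zero_of_mul (memLp_conj_mul_mul Θ g f)
      (memLp_conj_mul_mul Θ g _) (memLp_conj_mul_mul Θ _ f) hk.2 hf.2 ?_⟩
    filter_upwards [coeFn_mulLInf_star_symbol Θ θ p, coeFn_mulOp θ.toLInf p, hp.ae_ne_zero,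
      Θ.norm_eq_one, θ.norm_eq_one] with t h1 h2 h3 h4 h5
    have h4 := conj_mul_self_of_norm_eq_one h4
    have h5 := conj_mul_self_of_norm_eq_one h5
    have h6 : conj (p t) ≠ 0 := (map_ne_zero _).mpr h3
    rw [h1, h2]
    simp only [map_mul, map_div₀, Complex.conj_conj]
    field_simp
    linear_combination - coord t * Θ.toLInf t * conj (g t) * conj (f t) *
      (conj (θ.toLInf t) * θ.toLInf t * h4 + h5)

end ToeplitzKernels

/-! ### Rational inner factors and finite codimension -/

section FiniteDimension

theorem fourierCoeff_polynomial_mul (Q : ℂ[X]) {f : T → ℂ} (hf : MemLp f 2 m) (n : ℤ) :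
    fourierCoeff (fun t => Q.eval (coord t) * f t) n =
      ∑ j ∈ Finset.range (Q.natDegree + 1), Q.coeff j * fourierCoeff f (n - j) := by
  have h : (fun t => Q.eval (coord t) * f t) = ∑ j ∈ Finset.range (Q.natDegree + 1),
      fun t => Q.coeff j * (fourier (j : ℤ) t * f t) := by
    ext t
    rw [Finset.sum_apply, Polynomial.eval_eq_sum_range, Finset.sum_mul]
    refine Finset.sum_congr rfl fun j _ => ?_
    rw [coord_pow, mul_assoc]
  rw [h, fourierCoeff.sum]
  · rw [Finset.sum_apply]
    refine Finset.sum_congr rfl fun j _ => ?_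
    rw [fourierCoeff.const_mul, fourierCoeff_fourier_mul]
  · exact fun j _ => ((memLp_fourier_mul j hf).integrable one_le_two).const_mul _

/-- A sequence with finitely many prescribed initial zeros satisfying a linear recursion. -/
theorem eq_zero_of_polynomial_recursion {Q : ℂ[X]} (hQ : Q ≠ 0) {c : ℤ → ℂ} {d N : ℕ}
    (hN : d + Q.natDegree ≤ N) (hc : ∀ n : ℕ, n < N → c n = 0)
    (hrec : ∀ n : ℕ, d ≤ n → ∑ j ∈ Finset.range (Q.natDegree + 1), Q.coeff j * c (n - j) = 0)
    (n : ℕ) : c n = 0 := by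
  induction n using Nat.strong_induction_on with
  | _ n ih =>
    rcases lt_or_ge n N with h | h
    · exact hc n h
    · have hQ0 : Q.coeff Q.natTrailingDegree ≠ 0 :=
        Polynomial.trailingCoeff_nonzero_iff_nonzero.mpr hQ
      have hle := Q.natTrailingDegree_le_natDegree
      -- `Q` may vanish at the origin, so the recursion is solved through its lowest nonzero
      -- coefficient. The shift makes `c n` the newest term; `n ≥ N ≥ deg Q` keeps the older indices
      -- nonnegative.
      have h1 := hrec (n + Q.natTrailingDegree) (by omega)
      rw [Finset.sum_eq_single Q.natTrailingDegree] at h1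
      · have h2 : ((n + Q.natTrailingDegree : ℕ) : ℤ) - Q.natTrailingDegree = n := by omega
        rw [h2] at h1
        exact (mul_eq_zero.mp h1).resolve_left hQ0
      · intro j hj hne
        rcases lt_or_gt_of_ne hne with hlt | hgt
        · rw [Polynomial.coeff_eq_zero_of_lt_natTrailingDegree hlt, zero_mul]
        · have hj' : j ≤ Q.natDegree := by simpa [Nat.lt_succ_iff] using hj
          have h2 : ((n + Q.natTrailingDegree : ℕ) : ℤ) - j =
              ((n + Q.natTrailingDegree - j : ℕ) : ℤ) := by omega
          rw [h2, ih _ (by omega), mul_zero]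
      · intro h3
        exact absurd (Finset.mem_range.mpr (Nat.lt_succ_of_le hle)) h3

/-- Multiplying the symbol by the conjugate of a rational inner function preserves finite
dimensionality of the kernel. -/
theorem finiteDimensional_toeplitzKer_mulLInf (Θ : InnerFunction) {θ : InnerFunction}
    (hθ : θ.IsRational) (g : LInf) (hfin : FiniteDimensional ℂ (toeplitzKer H2 Θ.subspace g)) :
    FiniteDimensional ℂ (toeplitzKer H2 Θ.subspace (mulLInf (star θ.toLInf) g)) := by
  obtain ⟨P, Q, hQ, hPQ⟩ := hθ
  let A : L2 →L[ℂ] L2 := mulOp (star Θ.toLInf) ∘L mulOp g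
  have hA (f : L2) : A f =ᵐ[m] fun t => conj (Θ.toLInf t) * (g t * f t) := by
    filter_upwards [coeFn_mulOp (star Θ.toLInf) (mulOp g f), coeFn_mulOp g f,
      Lp.coeFn_star Θ.toLInf] with t h1 h2 h3
    change mulOp (star Θ.toLInf) (mulOp g f) t = _
    rw [h1, h2, h3]
    rfl
  let N : ℕ := P.natDegree + Q.natDegree
  -- `Φ` records the first `N` nonnegative coefficients of `A f`; the part of the larger kernel
  -- killed by `Φ` is shown to lie in the kernel of `g`.
  let Φ : L2 →ₗ[ℂ] (Fin N → ℂ) := LinearMap.pi fun i =>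
    ((innerSL ℂ (fourierBasis ((i : ℕ) : ℤ) : L2)) ∘L A : L2 →L[ℂ] ℂ)
  have hΦ (f : L2) (i : Fin N) : Φ f i = fourierCoeff (A f) (i : ℕ) := by
    rw [← inner_fourierBasis]
    rfl
  refine Module.Finite.iff_fg.mpr
    (Submodule.fg_of_fg_map_of_fg_inf_ker Φ (IsNoetherian.noetherian _) ?_)
  refine Module.Finite.iff_fg.mp (Submodule.finiteDimensional_of_le
    (S₂ := toeplitzKer H2 Θ.subspace g) ?_)
  rintro f ⟨hf, hf0⟩
  have hf := mem_toeplitzKer_iff.mp hf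
  refine mem_toeplitzKer_iff.mpr ⟨hf.1, fun n hn => ?_⟩
  obtain ⟨k, rfl⟩ : ∃ k : ℕ, n = -k := ⟨n.natAbs, by omega⟩
  rw [fourierCoeff_conj, neg_neg, ← fourierCoeff_congr_ae (hA f), map_eq_zero]
  refine eq_zero_of_polynomial_recursion (c := fourierCoeff (A f)) (d := P.natDegree) (N := N)
    hQ le_rfl (fun j hj => ?_) (fun j hj => ?_) k
  · rw [← hΦ f ⟨j, hj⟩, LinearMap.mem_ker.mp hf0, Pi.zero_apply]
  · rw [← fourierCoeff_polynomial_mul Q (Lp.memLp _)]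
    have hw := memLp_conj (memLp_conj_mul_mul Θ (mulLInf (star θ.toLInf) g) f)
    have h : (fun t => Q.eval (coord t) * A f t) =ᵐ[m] fun t => P.eval (coord t) *
        conj (conj (conj (Θ.toLInf t) * (mulLInf (star θ.toLInf) g t * f t))) := by
      filter_upwards [hA f, coeFn_mulLInf (star θ.toLInf) g, Lp.coeFn_star θ.toLInf, hPQ,
        θ.norm_eq_one] with t h1 h2 h3 h4 h5
      -- At a zero of `Q` the quotient would take the default value `0`, against `|θ| = 1`.
      have hQt : Q.eval (coord t) ≠ 0 := by
        intro h0
        rw [h4, h0, div_zero, norm_zero] at h5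
        exact zero_ne_one h5
      have h5 := conj_mul_self_of_norm_eq_one h5
      rw [h1, h2, h3, Complex.conj_conj, (eq_div_iff hQt).mp h4 |>.symm]
      change _ = _ * (_ * (conj (θ.toLInf t) * _ * _))
      linear_combination - Q.eval (coord t) * conj (Θ.toLInf t) * g t * f t * h5
    rw [fourierCoeff_congr_ae h, fourierCoeff_polynomial_mul P hw]
    -- `conj θ · A f` has only negative frequencies, so multiplying by `P` leaves nothing at indices
    -- `j ≥ deg P`.
    refine Finset.sum_eq_zero fun i hi => ?_
    have hi' : i ≤ P.natDegree := by simpa [Nat.lt_succ_iff] using hi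
    rw [fourierCoeff_conj, hf.2 _ (by omega), map_zero, mul_zero]

end FiniteDimension

end GenToeplitz

theorem mainTheorem8 (Θ₂ θ : InnerFunction) (hθ : θ.IsRational) (p : L2) (hp : IsOuter p)
    (hfin : FiniteDimensional ℂ (toeplitzKer H2 Θ₂.subspace (symbol Θ₂ p))) :
    ∃ K : Submodule ℂ L2,
      IsMinKernel H2 Θ₂.subspace (mulOp θ.toLInf p) K ∧ FiniteDimensional ℂ K :=
  ⟨_, isMinKernel_mulLInf_symbol Θ₂ θ hp,
    finiteDimensional_toeplitzKer_mulLInf Θ₂ hθ (symbol Θ₂ p) hfin⟩
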